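/- Let $a<b$, $I=[a,b]$, and let $f:I\to I$ be a $C^2$ map with a critical point $x_c\in(a,b)$ such that $f''(x_c)<0$, $f'(x)>0$ for all $x\in I$ with $x<x_c$, and $f'(x)<0$ for all $x\in I$ with $x>x_c$ (derivatives at $a$ and $b$ are one-sided; no further condition is imposed at the end-points). Let $f^n$ be the $n$-th iterate of $f$ ($f^0=\mathrm{id}$), and let $\ell_n$ be its lap number, i.e. the minimal number of intervals into which $I$ can be cut so that $f^n$ is monotone on each of them. The Min-Max sequence $\omega=(\omega_n)_{n\ge1}$ of $f$, over the alphabet $\{m^-,m^0,m^+,M^-,M^0,M^+\}$, records the type of the local extremum of $f^n$ at $x_c$: the letter is $m$ for a local minimum and $M$ for a local maximum, and the superscript is the sign of $f^n(x_c)-x_c$. Write $\operatorname{sign}(\omega_n)\in\{-1,0,1\}$ for the superscript. Put $$\mathcal M_b=\{m^+,M^-,m^0,M^0\},\qquad J_n=\{1\le j\le n:\ \omega_j\in\mathcal M_b\}.$$ Define $\lambda(0)=\rho(0)=0$ and, for $k\ge1$, $$\lambda(k)=\begin{cases}0&\text{if }\operatorname{sign}(f^k(a)-x_c)\,\operatorname{sign}(\omega_{1+\lambda(k-1)})<0,\\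 \lambda(k-1)+1&\text{otherwise,}\end{cases}$$ $$\alpha_k=\begin{cases}1&\text{if }\operatorname{sign}(f^k(a)-x_c)\,\operatorname{sign}(\omega_{1+\lambda(k-1)})\ge0\text{ and }\omega_{1+\lambda(k-1)}\notin\mathcal M_b,\\ 0&\text{otherwise,}\end{cases}$$ and define $\rho(k)$ and $\beta_k$ in the same way with $b$ in place of $a$ and $\rho$ in place of $\lambda$. Then every $\ell_n$ ($n\ge0$) is finite; for every $n\ge1$ the iterate $f^n$ has at $x_c$ a local extremum of exactly one of the six types, so that $\omega$ is well defined; $\ell_0=1$; and for every $n\ge1$ $$\ell_{n+1}=2\ell_n-2\sum_{j\in J_n}(\ell_{n+1-j}-\ell_{n-j})-\alpha_n-\beta_n .$$ -/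

import Mathlib

/-- The class of unimodal maps: `f` is a `C²` self-map of `[a, b]`, with a critical point `c` in
`(a, b)`, `f'' c < 0`, `f' > 0` to the left of `c` and `f' < 0` to the right of `c`.
Only the values of `f` on `[a, b]` matter; derivatives are relative to `[a, b]`
(one-sided at the end-points). -/
structure IsUnimodal (f : ℝ → ℝ) (a b c : ℝ) : Prop where
  mem_Ioo : c ∈ Set.Ioo a b
  mapsTo : Set.MapsTo f (Set.Icc a b) (Set.Icc a b)
  contDiffOn : ContDiffOn ℝ 2 f (Set.Icc a b)
  deriv_crit : derivWithin f (Set.Icc a b) c = 0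
  deriv2_crit_neg : iteratedDerivWithin 2 f (Set.Icc a b) c < 0
  deriv_pos : ∀ x ∈ Set.Icc a b, x < c → 0 < derivWithin f (Set.Icc a b) x
  deriv_neg : ∀ x ∈ Set.Icc a b, c < x → derivWithin f (Set.Icc a b) x < 0

/-- `[a, b]` can be cut by `a = p 0 < p 1 < ⋯ < p k = b` into `k` intervals on each of which `g`
is monotone (non-decreasing or non-increasing). -/
def HasMonotonePieces (g : ℝ → ℝ) (a b : ℝ) (k : ℕ) : Prop :=
  ∃ p : ℕ → ℝ, p 0 = a ∧ p k = b ∧ ∀ i < k, p i < p (i + 1) ∧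
    (MonotoneOn g (Set.Icc (p i) (p (i + 1))) ∨ AntitoneOn g (Set.Icc (p i) (p (i + 1))))

/-- The lap number of `f^n` on `[a, b]`: the minimal number of monotone pieces. -/
noncomputable def lapNumber (f : ℝ → ℝ) (a b : ℝ) (n : ℕ) : ℕ :=
  sInf {k : ℕ | HasMonotonePieces f^[n] a b k}

/-- The alphabet `{m⁻, m⁰, m⁺, M⁻, M⁰, M⁺}`. -/
inductive MinMaxSymbol
  | mNeg
  | mZero
  | mPos
  | MNeg
  | MZero
  | MPos
  deriving DecidableEq

/-- The sign (superscript) of a symbol. -/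
def MinMaxSymbol.sgn : MinMaxSymbol → SignType
  | .mNeg => -1
  | .mZero => 0
  | .mPos => 1
  | .MNeg => -1
  | .MZero => 0
  | .MPos => 1

/-- The set `{m⁺, M⁻, m⁰, M⁰}` of symbols. -/
def badSymbols : Finset MinMaxSymbol := {.mPos, .MNeg, .mZero, .MZero}

/-- `g` has at `x` a local extremum of the given type: `m` for a local minimum, `M` for a local
maximum, the superscript being the sign of `g x - c`. -/
def HasExtremumType (g : ℝ → ℝ) (c x : ℝ) : MinMaxSymbol → Prop
  | .mNeg => IsLocalMin g x ∧ g x < c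
  | .mZero => IsLocalMin g x ∧ g x = c
  | .mPos => IsLocalMin g x ∧ c < g x
  | .MNeg => IsLocalMax g x ∧ g x < c
  | .MZero => IsLocalMax g x ∧ g x = c
  | .MPos => IsLocalMax g x ∧ c < g x

open Classical in
/-- The Min-Max sequence `ω` of `f`: `ω n` (for `n ≥ 1`) is the type of the extremum of `f^n` at the
critical point `c`. The value at `n = 0` is irrelevant. -/
noncomputable def minMaxSeq (f : ℝ → ℝ) (c : ℝ) (n : ℕ) : MinMaxSymbol :=
  if IsLocalMax f^[n] c then
    if f^[n] c < c then .MNeg else if f^[n] c = c then .MZero else .MPos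
  else
    if f^[n] c < c then .mNeg else if f^[n] c = c then .mZero else .mPos

/-- The counter attached to an end-point `e` (it is `λ` for `e = a` and `ρ` for `e = b`). -/
noncomputable def endCounter (f : ℝ → ℝ) (c e : ℝ) : ℕ → ℕ
  | 0 => 0
  | k + 1 =>
    if SignType.sign (f^[k + 1] e - c) * (minMaxSeq f c (1 + endCounter f c e k)).sgn < 0 then 0
    else endCounter f c e k + 1

/-- The correction attached to an end-point `e`, for `k ≥ 1` (it is `α k` for `e = a` and `β k` for
`e = b`). -/
noncomputable def endCorrection (f : ℝ → ℝ) (c e : ℝ) (k : ℕ) : ℤ :=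
  if SignType.sign (f^[k] e - c) * (minMaxSeq f c (1 + endCounter f c e (k - 1))).sgn < 0 then 0
  else if minMaxSeq f c (1 + endCounter f c e (k - 1)) ∈ badSymbols then 0
  else 1

/-- `J n`, the set of `1 ≤ j ≤ n` with `ω j ∈ {m⁺, M⁻, m⁰, M⁰}`. -/
noncomputable def badIndices (f : ℝ → ℝ) (c : ℝ) (n : ℕ) : Finset ℕ :=
  (Finset.Icc 1 n).filter (fun j => minMaxSeq f c j ∈ badSymbols)

/-! The turning points of `f^n` are the interior points that reach `c` before time `n`; they cut
`[a, b]` into the laps, so `ℓ_n` is one more than their number and `ℓ_{n+1} - ℓ_n` counts the points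
that hit `c` first at time `n` (`lapNumber_succ`). On a lap `f^n` is strictly monotone, so the lap
contains one such point if `c` lies strictly between the end values, and none otherwise
(`ncard_firstHit_inter`).

Call a turning point bad if it is a maximum with value at most `c` or a minimum with value at least
`c`. Of the two ends of an inner lap one is the larger and one the smaller; the lap misses `c`
exactly when one end is bad, and both cannot be. So it contributes 1 minus its number of bad ends
(`ncard_inner_lap`). Summing, each bad turning point is subtracted twice, and the two end laps bring
in `α` and `β` (`ncard_end_lap`).

If `x` first hits `c` at time `n - j`, then `f^(n-j)` is a local homeomorphism at `x`, so the
extremum of `f^n` at `x` has type `ω_j`. Hence the bad points number the sum over `J_n` of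
`ℓ_{n+1-j} - ℓ_{n-j}` (`sum_badIndices`). -/

open Set Filter Topology

/-! ### Strict local extrema and unordered intervals -/

/-- `g` has a strict local maximum at `x`. -/
def StrictLocMax (g : ℝ → ℝ) (x : ℝ) : Prop := ∀ᶠ y in 𝓝 x, y ≠ x → g y < g x

/-- `g` has a strict local minimum at `x`. -/
def StrictLocMin (g : ℝ → ℝ) (x : ℝ) : Prop := ∀ᶠ y in 𝓝 x, y ≠ x → g x < g y

/-- No point strictly between `u` and `v` reaches `c` in fewer than `n` steps. -/
def NoTurn (f : ℝ → ℝ) (c : ℝ) (n : ℕ) (u v : ℝ) : Prop :=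
  ∀ y ∈ uIoo u v, ∀ k < n, f^[k] y ≠ c

/-- Points of `(a, b)` whose orbit reaches `c` for the first time at time `n`. -/
def firstHit (f : ℝ → ℝ) (a b c : ℝ) (n : ℕ) : Set ℝ :=
  {x | x ∈ Ioo a b ∧ f^[n] x = c ∧ ∀ k < n, f^[k] x ≠ c}

/-- The turning points of `f^n` in `(a, b)`. -/
def turning (f : ℝ → ℝ) (a b c : ℝ) (n : ℕ) : Set ℝ :=
  {x | x ∈ Ioo a b ∧ ∃ k < n, f^[k] x = c}

theorem exists_mem_uIoo_of_eventually {u w : ℝ} (huw : u ≠ w) {P : ℝ → Prop}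
    (h : ∀ᶠ y in 𝓝 u, P y) : ∃ y ∈ uIoo u w, P y := by
  have hu : u ∈ closure (uIoo u w) := by rw [closure_uIoo huw]; exact left_mem_uIcc
  obtain ⟨y, hy, hyu⟩ := mem_closure_iff_nhds.1 hu _ h
  exact ⟨y, hyu, hy⟩

theorem mem_uIcc_of_mem_uIoo {u w y : ℝ} (hy : y ∈ uIoo u w) : y ∈ uIcc u w :=
  uIoo_subset_uIcc_self hy

theorem ne_left_of_mem_uIoo {u w y : ℝ} (hy : y ∈ uIoo u w) : y ≠ u := by
  rintro rfl
  rcases le_total y w with h | h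
  · rw [uIoo_of_le h] at hy; exact lt_irrefl _ hy.1
  · rw [uIoo_of_ge h] at hy; exact lt_irrefl _ hy.2

theorem ne_right_of_mem_uIoo {u w y : ℝ} (hy : y ∈ uIoo u w) : y ≠ w := by
  rw [uIoo_comm] at hy; exact ne_left_of_mem_uIoo hy

/-- A strictly monotone function takes at an interior point of an interval a value strictly between
those at the end-points. -/
theorem map_uIoo_of_strict {g : ℝ → ℝ} {u v y : ℝ}
    (h : StrictMonoOn g (uIcc u v) ∨ StrictAntiOn g (uIcc u v)) (hy : y ∈ uIoo u v) :
    g y ∈ uIoo (g u) (g v) := by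
  wlog huv : u ≤ v generalizing u v
  · rw [uIoo_comm]
    rw [uIcc_comm] at h
    rw [uIoo_comm] at hy
    exact this h hy (le_of_not_ge huv)
  have hy' := hy
  rw [uIoo_of_le huv] at hy'
  have hu : u ∈ uIcc u v := left_mem_uIcc
  have hv : v ∈ uIcc u v := right_mem_uIcc
  have hyy := mem_uIcc_of_mem_uIoo hy
  rcases h with h | h
  · have h1 := h hu hyy hy'.1
    have h2 := h hyy hv hy'.2
    rw [uIoo_of_le (h1.trans h2).le]
    exact ⟨h1, h2⟩
  · have h1 := h hu hyy hy'.1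
    have h2 := h hyy hv hy'.2
    rw [uIoo_of_ge (h2.trans h1).le]
    exact ⟨h2, h1⟩

/-- One point near `u` fixes the direction of monotonicity on the whole interval. This tells which
end of a lap carries the larger value. -/
theorem StrictLocMax.lt_of_strict {g : ℝ → ℝ} {u w : ℝ} (huw : u ≠ w) (hg : StrictLocMax g u)
    (h : StrictMonoOn g (uIcc u w) ∨ StrictAntiOn g (uIcc u w)) : g w < g u := by
  obtain ⟨y, hy, hyP⟩ := exists_mem_uIoo_of_eventually huw hg
  have h1 := hyP (ne_left_of_mem_uIoo hy)
  have h2 := map_uIoo_of_strict h hy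
  rcases le_total (g u) (g w) with h' | h'
  · rw [uIoo_of_le h'] at h2; exact absurd h2.1 h1.not_gt
  · rw [uIoo_of_ge h'] at h2; exact h2.1.trans h2.2

theorem StrictLocMin.lt_of_strict {g : ℝ → ℝ} {u w : ℝ} (huw : u ≠ w) (hg : StrictLocMin g u)
    (h : StrictMonoOn g (uIcc u w) ∨ StrictAntiOn g (uIcc u w)) : g u < g w := by
  obtain ⟨y, hy, hyP⟩ := exists_mem_uIoo_of_eventually huw hg
  have h1 := hyP (ne_left_of_mem_uIoo hy)
  have h2 := map_uIoo_of_strict h hy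
  rcases le_total (g u) (g w) with h' | h'
  · rw [uIoo_of_le h'] at h2; exact h2.1.trans h2.2
  · rw [uIoo_of_ge h'] at h2; exact absurd h2.2 h1.not_gt

theorem StrictLocMax.isLocalMax {g : ℝ → ℝ} {x : ℝ} (h : StrictLocMax g x) : IsLocalMax g x := by
  filter_upwards [h] with y hy
  by_cases hyx : y = x
  · rw [hyx]
  · exact (hy hyx).le

theorem StrictLocMin.isLocalMin {g : ℝ → ℝ} {x : ℝ} (h : StrictLocMin g x) : IsLocalMin g x := by
  filter_upwards [h] with y hy
  by_cases hyx : y = x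
  · rw [hyx]
  · exact (hy hyx).le

theorem StrictLocMax.not_isLocalMin {g : ℝ → ℝ} {x : ℝ} (h : StrictLocMax g x) :
    ¬ IsLocalMin g x := fun h' => by
  obtain ⟨y, hy, h1, h2⟩ := exists_mem_uIoo_of_eventually (w := x + 1) (by linarith) (h.and h')
  exact absurd h2 (h1 (ne_left_of_mem_uIoo hy)).not_ge

theorem StrictLocMin.not_isLocalMax {g : ℝ → ℝ} {x : ℝ} (h : StrictLocMin g x) :
    ¬ IsLocalMax g x := fun h' => by
  obtain ⟨y, hy, h1, h2⟩ := exists_mem_uIoo_of_eventually (w := x + 1) (by linarith) (h.and h')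
  exact absurd h2 (h1 (ne_left_of_mem_uIoo hy)).not_ge

theorem StrictLocMax.not_strictLocMin {g : ℝ → ℝ} {x : ℝ} (h : StrictLocMax g x) :
    ¬ StrictLocMin g x := fun h' => h.not_isLocalMin h'.isLocalMin

theorem not_monotone_of_strictLocExtr {g : ℝ → ℝ} {x p q : ℝ} (hx : x ∈ Ioo p q)
    (h : StrictLocMax g x ∨ StrictLocMin g x) :
    ¬ (MonotoneOn g (Icc p q) ∨ AntitoneOn g (Icc p q)) := by
  have hmem : ∀ {y z : ℝ}, y ∈ uIoo x z → z ∈ Icc p q → y ∈ Icc p q := fun hy hz =>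
    ordConnected_Icc.uIcc_subset ⟨hx.1.le, hx.2.le⟩ hz (mem_uIcc_of_mem_uIoo hy)
  have hpq := (hx.1.trans hx.2).le
  have key : ∀ P : ℝ → Prop, (∀ᶠ y in 𝓝 x, y ≠ x → P y) →
      (∃ y ∈ Icc p q, y ≤ x ∧ P y) ∧ (∃ y ∈ Icc p q, x ≤ y ∧ P y) := fun P hP => by
    obtain ⟨y, hy, h1⟩ := exists_mem_uIoo_of_eventually hx.1.ne' hP
    obtain ⟨z, hz, h2⟩ := exists_mem_uIoo_of_eventually hx.2.ne hP
    refine ⟨⟨y, hmem hy (left_mem_Icc.2 hpq), ?_, h1 (ne_left_of_mem_uIoo hy)⟩,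
      ⟨z, hmem hz (right_mem_Icc.2 hpq), ?_, h2 (ne_left_of_mem_uIoo hz)⟩⟩
    · rw [uIoo_of_ge hx.1.le] at hy; exact hy.2.le
    · rw [uIoo_of_le hx.2.le] at hz; exact hz.1.le
  have hxm : x ∈ Icc p q := ⟨hx.1.le, hx.2.le⟩
  rintro (hm | hm) <;> rcases h with h | h <;>
    obtain ⟨⟨y, hy, hyx, h1⟩, ⟨z, hz, hxz, h2⟩⟩ := key _ h
  · exact absurd (hm hxm hz hxz) h2.not_ge
  · exact absurd (hm hy hxm hyx) h1.not_ge
  · exact absurd (hm hy hxm hyx) h1.not_ge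
  · exact absurd (hm hxm hz hxz) h2.not_ge

/-! ### Iterates of a unimodal map: monotonicity, finite fibres, local extrema -/

namespace IsUnimodal

variable {f : ℝ → ℝ} {a b c : ℝ}

theorem lt (hf : IsUnimodal f a b c) : a < b := hf.mem_Ioo.1.trans hf.mem_Ioo.2

theorem continuousOn (hf : IsUnimodal f a b c) : ContinuousOn f (Icc a b) :=
  hf.contDiffOn.continuousOn

theorem strictMonoOn (hf : IsUnimodal f a b c) : StrictMonoOn f (Icc a c) := by
  refine strictMonoOn_of_deriv_pos (convex_Icc a c)
    (hf.continuousOn.mono (Icc_subset_Icc_right hf.mem_Ioo.2.le)) fun x hx => ?_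
  rw [interior_Icc] at hx
  have hxb := hx.2.trans hf.mem_Ioo.2
  have := hf.deriv_pos x ⟨hx.1.le, hxb.le⟩ hx.2
  rwa [derivWithin_of_mem_nhds (Icc_mem_nhds hx.1 hxb)] at this

theorem strictAntiOn (hf : IsUnimodal f a b c) : StrictAntiOn f (Icc c b) := by
  refine strictAntiOn_of_deriv_neg (convex_Icc c b)
    (hf.continuousOn.mono (Icc_subset_Icc_left hf.mem_Ioo.1.le)) fun x hx => ?_
  rw [interior_Icc] at hx
  have hax := hf.mem_Ioo.1.trans hx.1
  have := hf.deriv_neg x ⟨hax.le, hx.2.le⟩ hx.1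
  rwa [derivWithin_of_mem_nhds (Icc_mem_nhds hax hx.2)] at this

/-- Inverse function theorem: the derivative vanishes only at `c`. Iterated, this transports extrema
from `c` to its preimages. -/
theorem map_nhds (hf : IsUnimodal f a b c) {x : ℝ} (hx : x ∈ Ioo a b) (hxc : x ≠ c) :
    map f (𝓝 x) = 𝓝 (f x) := by
  have hn := Icc_mem_nhds hx.1 hx.2
  have hd : HasStrictDerivAt f (deriv f x) x :=
    (hf.contDiffOn.contDiffAt hn).hasStrictDerivAt two_ne_zero
  refine hd.map_nhds_eq ?_
  rw [← derivWithin_of_mem_nhds hn]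
  rcases lt_or_gt_of_ne hxc with h | h
  · exact (hf.deriv_pos x (Ioo_subset_Icc_self hx) h).ne'
  · exact (hf.deriv_neg x (Ioo_subset_Icc_self hx) h).ne

theorem map_lt (hf : IsUnimodal f a b c) {x : ℝ} (hx : x ∈ Icc a b) (hxc : x ≠ c) :
    f x < f c := by
  have hc := hf.mem_Ioo
  rcases lt_or_gt_of_ne hxc with h | h
  · exact hf.strictMonoOn ⟨hx.1, h.le⟩ ⟨hc.1.le, le_rfl⟩ h
  · exact hf.strictAntiOn ⟨le_rfl, hc.2.le⟩ ⟨h.le, hx.2⟩ h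

theorem map_mem_Ioo (hf : IsUnimodal f a b c) {x : ℝ} (hx : x ∈ Ioo a b) (hxc : x ≠ c) :
    f x ∈ Ioo a b := by
  have hc := hf.mem_Ioo
  refine ⟨?_, (hf.map_lt (Ioo_subset_Icc_self hx) hxc).trans_le
    (hf.mapsTo (Ioo_subset_Icc_self hc)).2⟩
  rcases lt_or_gt_of_ne hxc with h | h
  · exact (hf.mapsTo (left_mem_Icc.2 hf.lt.le)).1.trans_lt
      (hf.strictMonoOn ⟨le_rfl, hc.1.le⟩ ⟨hx.1.le, h.le⟩ hx.1)
  · exact (hf.mapsTo (right_mem_Icc.2 hf.lt.le)).1.trans_lt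
      (hf.strictAntiOn ⟨h.le, hx.2.le⟩ ⟨hc.2.le, le_rfl⟩ hx.2)

theorem iterate_map_nhds (hf : IsUnimodal f a b c) (k : ℕ) {x : ℝ} (hx : x ∈ Ioo a b)
    (hk : ∀ i < k, f^[i] x ≠ c) : f^[k] x ∈ Ioo a b ∧ map f^[k] (𝓝 x) = 𝓝 (f^[k] x) := by
  induction k with
  | zero => exact ⟨hx, map_id⟩
  | succ k ih =>
    obtain ⟨h1, h2⟩ := ih fun i hi => hk i (hi.trans (Nat.lt_succ_self k))
    have h3 := hk k (Nat.lt_succ_self k)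
    rw [Function.iterate_succ']
    refine ⟨hf.map_mem_Ioo h1 h3, ?_⟩
    rw [← Filter.map_map, h2, hf.map_nhds h1 h3, Function.comp_apply]

theorem iterate_mapsTo (hf : IsUnimodal f a b c) (n : ℕ) : MapsTo f^[n] (Icc a b) (Icc a b) :=
  hf.mapsTo.iterate n

theorem iterate_continuousOn (hf : IsUnimodal f a b c) (n : ℕ) :
    ContinuousOn f^[n] (Icc a b) := by
  induction n with
  | zero => exact continuousOn_id
  | succ n ih =>
    rw [Function.iterate_succ']
    exact hf.continuousOn.comp ih (hf.iterate_mapsTo n)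

theorem finite_preimage (hf : IsUnimodal f a b c) (s : Set ℝ) (hs : s.Finite) :
    (Icc a b ∩ f ⁻¹' s).Finite := by
  have h1 : (Icc a c ∩ f ⁻¹' s).Finite :=
    Set.Finite.of_finite_image (hs.subset (by rintro _ ⟨x, hx, rfl⟩; exact hx.2))
      (hf.strictMonoOn.injOn.mono inter_subset_left)
  have h2 : (Icc c b ∩ f ⁻¹' s).Finite :=
    Set.Finite.of_finite_image (hs.subset (by rintro _ ⟨x, hx, rfl⟩; exact hx.2))
      (hf.strictAntiOn.injOn.mono inter_subset_left)
  refine (h1.union h2).subset fun x hx => ?_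
  rcases le_total x c with h | h
  · exact Or.inl ⟨⟨hx.1.1, h⟩, hx.2⟩
  · exact Or.inr ⟨⟨h, hx.1.2⟩, hx.2⟩

theorem finite_fiber (hf : IsUnimodal f a b c) (n : ℕ) (y : ℝ) :
    {x | x ∈ Icc a b ∧ f^[n] x = y}.Finite := by
  induction n with
  | zero => exact (finite_singleton y).subset fun x hx => hx.2
  | succ n ih =>
    refine (hf.finite_preimage _ ih).subset fun x hx => ⟨hx.1, hf.mapsTo hx.1, ?_⟩
    rw [← Function.iterate_succ_apply]; exact hx.2

theorem finite_turning (hf : IsUnimodal f a b c) (n : ℕ) : (turning f a b c n).Finite := by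
  refine ((Set.finite_Iio n).biUnion fun k _ => hf.finite_fiber k c).subset ?_
  rintro x ⟨hx, k, hk, hkc⟩
  exact mem_biUnion (show k ∈ Iio n from hk) ⟨Ioo_subset_Icc_self hx, hkc⟩

theorem finite_firstHit (hf : IsUnimodal f a b c) (n : ℕ) : (firstHit f a b c n).Finite :=
  (hf.finite_fiber n c).subset fun _ hx => ⟨Ioo_subset_Icc_self hx.1, hx.2.1⟩

/-- Between consecutive turning points an iterate is strictly monotone. -/
theorem strict_of_noTurn (hf : IsUnimodal f a b c) (n : ℕ) {u v : ℝ} (hu : u ∈ Icc a b)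
    (hv : v ∈ Icc a b) (h : NoTurn f c n u v) :
    StrictMonoOn f^[n] (uIcc u v) ∨ StrictAntiOn f^[n] (uIcc u v) := by
  induction n with
  | zero => exact Or.inl fun x _ y _ hxy => hxy
  | succ n ih =>
    have ih' := ih fun y hy k hk => h y hy k (hk.trans (Nat.lt_succ_self n))
    have hsub : uIcc u v ⊆ Icc a b := ordConnected_Icc.uIcc_subset hu hv
    have hcont := (hf.iterate_continuousOn n).mono hsub
    -- If the image met both sides of `c`, the intermediate value theorem would give an interior
    -- point hitting `c` at time `n`. So a single monotone branch of `f` acts next.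
    have hmaps : MapsTo f^[n] (uIcc u v) (Icc a c) ∨ MapsTo f^[n] (uIcc u v) (Icc c b) := by
      by_contra! hcon
      simp only [MapsTo, not_forall] at hcon
      obtain ⟨⟨x, hx, hx'⟩, ⟨y, hy, hy'⟩⟩ := hcon
      have hxI := hf.iterate_mapsTo n (hsub hx)
      have hyI := hf.iterate_mapsTo n (hsub hy)
      have hx1 : c < f^[n] x := not_le.1 fun hh => hx' ⟨hxI.1, hh⟩
      have hy1 : f^[n] y < c := not_le.1 fun hh => hy' ⟨hh, hyI.2⟩
      have hss : uIcc x y ⊆ uIcc u v := uIcc_subset_uIcc hx hy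
      have hiv := intermediate_value_uIcc (hcont.mono hss)
      obtain ⟨z, hz, hzc⟩ := hiv (show c ∈ uIcc (f^[n] x) (f^[n] y) by
        rw [uIcc_of_ge (hy1.trans hx1).le]; exact ⟨hy1.le, hx1.le⟩)
      have hzx : z ≠ x := by rintro rfl; exact hx1.ne' hzc
      have hzy : z ≠ y := by rintro rfl; exact hy1.ne hzc
      refine h z ?_ n (Nat.lt_succ_self n) hzc
      rcases le_total u v with huv | huv
      · rw [uIoo_of_le huv]; rw [uIcc_of_le huv] at hx hy
        rcases le_total x y with hxy | hxy
        · rw [uIcc_of_le hxy] at hz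
          exact ⟨hx.1.trans_lt (lt_of_le_of_ne hz.1 hzx.symm),
            (lt_of_le_of_ne hz.2 hzy).trans_le hy.2⟩
        · rw [uIcc_of_ge hxy] at hz
          exact ⟨hy.1.trans_lt (lt_of_le_of_ne hz.1 hzy.symm),
            (lt_of_le_of_ne hz.2 hzx).trans_le hx.2⟩
      · rw [uIoo_of_ge huv]; rw [uIcc_of_ge huv] at hx hy
        rcases le_total x y with hxy | hxy
        · rw [uIcc_of_le hxy] at hz
          exact ⟨hx.1.trans_lt (lt_of_le_of_ne hz.1 hzx.symm),
            (lt_of_le_of_ne hz.2 hzy).trans_le hy.2⟩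
        · rw [uIcc_of_ge hxy] at hz
          exact ⟨hy.1.trans_lt (lt_of_le_of_ne hz.1 hzy.symm),
            (lt_of_le_of_ne hz.2 hzx).trans_le hx.2⟩
    rw [Function.iterate_succ']
    rcases hmaps with hm | hm <;> rcases ih' with hi | hi
    · exact Or.inl (hf.strictMonoOn.comp hi hm)
    · exact Or.inr (hf.strictMonoOn.comp_strictAntiOn hi hm)
    · exact Or.inr (hf.strictAntiOn.comp_strictMonoOn hi hm)
    · exact Or.inl (hf.strictAntiOn.comp hi hm)

/-- An interval without turning points contains exactly one new turning point if the end-point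
values lie strictly on both sides of `c`, and none otherwise. -/
theorem ncard_firstHit_inter (hf : IsUnimodal f a b c) (n : ℕ) {u v : ℝ} (hu : u ∈ Icc a b)
    (hv : v ∈ Icc a b) (h : NoTurn f c n u v) :
    (c ∈ uIoo (f^[n] u) (f^[n] v) →
      ∃ y ∈ uIoo u v, y ∈ firstHit f a b c n ∧ firstHit f a b c n ∩ uIoo u v = {y}) ∧
    (c ∉ uIoo (f^[n] u) (f^[n] v) → firstHit f a b c n ∩ uIoo u v = ∅) := by
  have hsub : uIcc u v ⊆ Icc a b := ordConnected_Icc.uIcc_subset hu hv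
  have hst := hf.strict_of_noTurn n hu hv h
  constructor
  · intro hc
    obtain ⟨y, hy, hyc⟩ := intermediate_value_uIcc ((hf.iterate_continuousOn n).mono hsub)
      (mem_uIcc_of_mem_uIoo hc)
    have hyu : y ≠ u := by rintro rfl; exact ne_left_of_mem_uIoo hc hyc.symm
    have hyv : y ≠ v := by rintro rfl; exact ne_right_of_mem_uIoo hc hyc.symm
    have hyI : y ∈ uIoo u v := by
      rcases le_total u v with huv | huv
      · rw [uIcc_of_le huv] at hy; rw [uIoo_of_le huv]
        exact ⟨lt_of_le_of_ne hy.1 hyu.symm, lt_of_le_of_ne hy.2 hyv⟩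
      · rw [uIcc_of_ge huv] at hy; rw [uIoo_of_ge huv]
        exact ⟨lt_of_le_of_ne hy.1 hyv.symm, lt_of_le_of_ne hy.2 hyu⟩
    have hyab : y ∈ Ioo a b := by
      rcases le_total u v with huv | huv
      · rw [uIoo_of_le huv] at hyI; exact ⟨hu.1.trans_lt hyI.1, hyI.2.trans_le hv.2⟩
      · rw [uIoo_of_ge huv] at hyI; exact ⟨hv.1.trans_lt hyI.1, hyI.2.trans_le hu.2⟩
    have hyN : y ∈ firstHit f a b c n := ⟨hyab, hyc, h y hyI⟩
    refine ⟨y, hyI, hyN, ?_⟩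
    have hinj : InjOn f^[n] (uIcc u v) := hst.elim (·.injOn) (·.injOn)
    ext z
    refine ⟨fun hz => hinj (mem_uIcc_of_mem_uIoo hz.2) hy (hz.1.2.1.trans hyc.symm), ?_⟩
    rintro rfl
    exact ⟨hyN, hyI⟩
  · intro hc
    refine eq_empty_of_forall_notMem fun z hz => hc ?_
    rw [← hz.1.2.1]
    exact map_uIoo_of_strict hst hz.2

theorem exists_noTurn_left (hf : IsUnimodal f a b c) (n : ℕ) {x : ℝ} (hx : a < x) (hxb : x ≤ b) :
    ∃ u ∈ Ico a x, NoTurn f c n u x := by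
  have hfin : (turning f a b c n ∩ Iio x).Finite := (hf.finite_turning n).inter_of_left _
  obtain ⟨m, hm, hmax⟩ := (hfin.insert a).exists_maximal ⟨a, mem_insert _ _⟩
  have hmx : m < x := by
    rcases hm with rfl | hm
    · exact hx
    · exact hm.2
  have ham : a ≤ m := by
    rcases hm with rfl | hm
    · exact le_rfl
    · exact hm.1.1.1.le
  refine ⟨m, ⟨ham, hmx⟩, fun y hy k hk hyc => ?_⟩
  rw [uIoo_of_le hmx.le] at hy
  have := hmax (mem_insert_of_mem a ⟨⟨⟨ham.trans_lt hy.1, hy.2.trans_le hxb⟩, k, hk, hyc⟩, hy.2⟩)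
    hy.1.le
  exact absurd hy.1 this.not_gt

/-- Each iterate has a strict local extremum at the critical point. -/
theorem strictLocExtr_crit (hf : IsUnimodal f a b c) (n : ℕ) :
    StrictLocMax f^[n + 1] c ∨ StrictLocMin f^[n + 1] c := by
  have hc := hf.mem_Ioo
  have hcI := Ioo_subset_Icc_self hc
  have hfc := hf.mapsTo hcI
  have hac : a < f c := (hf.mapsTo (left_mem_Icc.2 hf.lt.le)).1.trans_lt
    (hf.map_lt (left_mem_Icc.2 hf.lt.le) hc.1.ne)
  -- Near `c`, `f` takes values only just below `f c`, so one-sided monotonicity of `f^n` on `[u, f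
  -- c]` is enough.
  obtain ⟨u, hu, hno⟩ := hf.exists_noTurn_left n hac hfc.2
  have hst := hf.strict_of_noTurn n ⟨hu.1, hu.2.le.trans hfc.2⟩ hfc hno
  rw [uIcc_of_le hu.2.le] at hst
  have hev : ∀ᶠ y in 𝓝 c, y ≠ c → f y ∈ Ico u (f c) := by
    have hcont : ContinuousAt f c := hf.continuousOn.continuousAt (Icc_mem_nhds hc.1 hc.2)
    filter_upwards [hcont.eventually_const_lt hu.2, Icc_mem_nhds hc.1 hc.2] with y hy1 hy2 hyc
    exact ⟨hy1.le, hf.map_lt hy2 hyc⟩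
  rcases hst with hs | hs
  · left
    filter_upwards [hev] with y hy hyc
    have := hy hyc
    exact hs ⟨this.1, this.2.le⟩ (right_mem_Icc.2 hu.2.le) this.2
  · right
    filter_upwards [hev] with y hy hyc
    have := hy hyc
    exact hs ⟨this.1, this.2.le⟩ (right_mem_Icc.2 hu.2.le) this.2

theorem eventually_iterate_ne (hf : IsUnimodal f a b c) (k : ℕ) {x : ℝ} (hx : x ∈ Ioo a b) :
    ∀ᶠ y in 𝓝 x, y ≠ x → f^[k] y ≠ c := by
  have hfin : ({y | y ∈ Icc a b ∧ f^[k] y = c} \ {x}).Finite := (hf.finite_fiber k c).sdiff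
  have := hfin.isClosed.isOpen_compl.mem_nhds (show x ∈ _ from fun h => h.2 rfl)
  filter_upwards [this, Icc_mem_nhds hx.1 hx.2] with y hy hyI hyx hyc
  exact hy ⟨⟨hyI, hyc⟩, hyx⟩

/-- `f^k` carries neighbourhoods of `x` onto neighbourhoods of `c`, whatever its orientation;
finiteness of the fibre over `c` keeps the extremum strict. -/
theorem strictLocMax_of_firstHit (hf : IsUnimodal f a b c) {k j : ℕ} {x : ℝ}
    (hx : x ∈ firstHit f a b c k) (h : StrictLocMax f^[j] c) : StrictLocMax f^[j + k] x := by
  have hmap := (hf.iterate_map_nhds k hx.1 hx.2.2).2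
  rw [hx.2.1] at hmap
  rw [StrictLocMax, ← hmap, eventually_map] at h
  filter_upwards [h, hf.eventually_iterate_ne k hx.1] with y h1 h2 hyx
  rw [Function.iterate_add_apply, Function.iterate_add_apply, hx.2.1]
  exact h1 (h2 hyx)

theorem strictLocMin_of_firstHit (hf : IsUnimodal f a b c) {k j : ℕ} {x : ℝ}
    (hx : x ∈ firstHit f a b c k) (h : StrictLocMin f^[j] c) : StrictLocMin f^[j + k] x := by
  have hmap := (hf.iterate_map_nhds k hx.1 hx.2.2).2
  rw [hx.2.1] at hmap
  rw [StrictLocMin, ← hmap, eventually_map] at h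
  filter_upwards [h, hf.eventually_iterate_ne k hx.1] with y h1 h2 hyx
  rw [Function.iterate_add_apply, Function.iterate_add_apply, hx.2.1]
  exact h1 (h2 hyx)

end IsUnimodal

/-! ### Bad extrema, ordered cuts and the sign criterion -/

/-- `g` has at `x` a strict local maximum with value at most `c`, or a strict local minimum with
value at least `c`. -/
def BadExtr (g : ℝ → ℝ) (c x : ℝ) : Prop :=
  (StrictLocMax g x ∧ g x ≤ c) ∨ (StrictLocMin g x ∧ c ≤ g x)

theorem le_of_forall_step {p : ℕ → ℝ} {k : ℕ} (hp : ∀ i < k, p i < p (i + 1)) {i j : ℕ}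
    (hij : i ≤ j) (hj : j ≤ k) : p i ≤ p j := by
  induction j, hij using Nat.le_induction with
  | base => exact le_rfl
  | succ j _ ih => exact (ih (by omega)).trans (hp j (by omega)).le

theorem exists_step_mem_Ico {p : ℕ → ℝ} {k : ℕ} {x : ℝ} (h0 : p 0 ≤ x) (hk : x < p k) :
    ∃ i < k, x ∈ Ico (p i) (p (i + 1)) := by
  induction k with
  | zero => exact absurd h0 hk.not_ge
  | succ k ih =>
    rcases lt_or_ge x (p k) with h | h
    · obtain ⟨i, hi, hx⟩ := ih h
      exact ⟨i, by omega, hx⟩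
    · exact ⟨k, by omega, h, hk⟩

/-- Enumeration of a finite set of points of `(a, b)` in increasing order. -/
theorem exists_cuts (T : Finset ℝ) {a : ℝ} : ∀ {b : ℝ}, a < b → (∀ x ∈ T, x ∈ Ioo a b) →
    ∃ p : ℕ → ℝ, p 0 = a ∧ p (T.card + 1) = b ∧ (∀ i < T.card + 1, p i < p (i + 1)) ∧
      (Finset.range T.card).image (fun i => p (i + 1)) = T ∧
      ∀ i < T.card + 1, ∀ x ∈ T, x ∉ Ioo (p i) (p (i + 1)) := by
  -- The right end-point varies: the points below the largest one `m` are enumerated in `(a, m)`.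
  induction T using Finset.induction_on_max with
  | empty =>
    intro b hab _
    refine ⟨fun i => if i = 0 then a else b, by simp, by simp, ?_, by simp, by simp⟩
    intro i hi
    have : i = 0 := by simpa using hi
    simp [this, hab]
  | insert m T hm ih =>
    intro b hab hT
    have hmab := hT m (Finset.mem_insert_self m T)
    obtain ⟨p, h0, h1, h2, h3, h4⟩ := ih hmab.1 fun x hx =>
      ⟨(hT x (Finset.mem_insert_of_mem hx)).1, hm x hx⟩
    have hnot : m ∉ T := fun h => lt_irrefl _ (hm m h)
    have hle : ∀ i ≤ T.card + 1, p i ≤ m := fun i hi => h1 ▸ le_of_forall_step h2 hi le_rfl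
    rw [Finset.card_insert_of_notMem hnot]
    refine ⟨fun i => if i ≤ T.card + 1 then p i else b, by simp [h0], by simp, ?_, ?_, ?_⟩
    · intro i hi
      rcases Nat.lt_or_ge i (T.card + 1) with h | h
      · simp only [h.le, if_true, Nat.succ_le_iff.2 h]
        exact h2 i h
      · obtain rfl : i = T.card + 1 := by omega
        simp [h1, hmab.2]
    · rw [Finset.range_add_one, Finset.image_insert]
      congr 1
      · simp [h1]
      · conv_rhs => rw [← h3]
        refine Finset.image_congr fun i hi => ?_
        have hi' : i < T.card := by simpa using hi
        simp [hi'.le]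
    · intro i hi x hx
      rcases Nat.lt_or_ge i (T.card + 1) with h | h
      · simp only [h.le, if_true, Nat.succ_le_iff.2 h]
        rcases Finset.mem_insert.1 hx with rfl | hx
        · exact fun hh => (hle (i + 1) h).not_gt hh.2
        · exact h4 i h x hx
      · obtain rfl : i = T.card + 1 := by omega
        simp only [le_refl, if_true, h1]
        rcases Finset.mem_insert.1 hx with rfl | hx
        · exact fun hh => lt_irrefl _ hh.1
        · exact fun hh => (hm x hx).not_gt hh.1

theorem sign_mul_sign_neg_iff (s t c : ℝ) :
    SignType.sign (s - c) * SignType.sign (t - c) < 0 ↔ c ∈ uIoo s t := by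
  have hneg : ∀ x : SignType, x < 0 ↔ x = -1 := by decide
  rw [← sign_mul, hneg, sign_eq_neg_one_iff, mul_neg_iff, sub_pos, sub_neg, sub_neg, sub_pos]
  rcases le_total s t with h | h
  · rw [uIoo_of_le h, mem_Ioo]; grind
  · rw [uIoo_of_ge h, mem_Ioo]; grind

/-! ### Types of turning points and new turning points on one lap -/

namespace IsUnimodal

variable {f : ℝ → ℝ} {a b c : ℝ}

theorem turning_succ (n : ℕ) :
    turning f a b c (n + 1) = turning f a b c n ∪ firstHit f a b c n := by
  ext x
  constructor
  · rintro ⟨hx, k, hk, hkc⟩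
    by_cases h : ∃ k < n, f^[k] x = c
    · exact Or.inl ⟨hx, h⟩
    · push Not at h
      have : k = n := by
        by_contra hne
        exact h k (by omega) hkc
      exact Or.inr ⟨hx, this ▸ hkc, h⟩
  · rintro (⟨hx, k, hk, hkc⟩ | ⟨hx, h, -⟩)
    · exact ⟨hx, k, by omega, hkc⟩
    · exact ⟨hx, n, by omega, h⟩

theorem disjoint_turning_firstHit (n : ℕ) :
    Disjoint (turning f a b c n) (firstHit f a b c n) :=
  Set.disjoint_left.2 fun _ ⟨_, k, hk, hkc⟩ h => h.2.2 k hk hkc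

theorem ncard_turning_succ (hf : IsUnimodal f a b c) (n : ℕ) :
    (turning f a b c (n + 1)).ncard = (turning f a b c n).ncard + (firstHit f a b c n).ncard := by
  rw [turning_succ, Set.ncard_union_eq (disjoint_turning_firstHit n) (hf.finite_turning n)
    (hf.finite_firstHit n)]

theorem exists_firstHit_of_mem_turning {n : ℕ} {x : ℝ} (hx : x ∈ turning f a b c n) :
    ∃ k < n, x ∈ firstHit f a b c k := by
  classical
  obtain ⟨hx, h⟩ := hx
  have hn := Nat.find_spec h
  refine ⟨Nat.find h, hn.1, hx, hn.2, fun k hk hkc => Nat.find_min h hk ⟨hk.trans hn.1, hkc⟩⟩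

theorem mem_turning_of_firstHit {n k : ℕ} {x : ℝ} (hk : k < n) (hx : x ∈ firstHit f a b c k) :
    x ∈ turning f a b c n := ⟨hx.1, k, hk, hx.2.1⟩

theorem firstHit_unique {k l : ℕ} {x : ℝ} (hk : x ∈ firstHit f a b c k)
    (hl : x ∈ firstHit f a b c l) : k = l := by
  rcases lt_trichotomy k l with h | h | h
  · exact absurd hk.2.1 (hl.2.2 k h)
  · exact h
  · exact absurd hl.2.1 (hk.2.2 l h)

theorem strictLocExtr_of_mem_turning (hf : IsUnimodal f a b c) {n : ℕ} {x : ℝ}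
    (hx : x ∈ turning f a b c n) : StrictLocMax f^[n] x ∨ StrictLocMin f^[n] x := by
  obtain ⟨k, hk, hxk⟩ := exists_firstHit_of_mem_turning hx
  obtain ⟨j, rfl⟩ : ∃ j, n = j + 1 + k := ⟨n - 1 - k, by omega⟩
  exact (hf.strictLocExtr_crit j).imp (hf.strictLocMax_of_firstHit hxk)
    (hf.strictLocMin_of_firstHit hxk)

/-- Strictness makes the two cases exclusive, which justifies `minMaxSeq` treating every non-maximum
as a minimum. -/
theorem isLocalMin_iff (hf : IsUnimodal f a b c) (n : ℕ) :
    IsLocalMin f^[n + 1] c ↔ ¬ IsLocalMax f^[n + 1] c := by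
  rcases hf.strictLocExtr_crit n with h | h
  · exact iff_of_false h.not_isLocalMin (not_not.2 h.isLocalMax)
  · exact iff_of_true h.isLocalMin h.not_isLocalMax

theorem hasExtremumType_iff (hf : IsUnimodal f a b c) (n : ℕ) (s : MinMaxSymbol) :
    HasExtremumType f^[n + 1] c c s ↔ s = minMaxSeq f c (n + 1) := by
  have h := hf.isLocalMin_iff n
  unfold minMaxSeq
  by_cases hM : IsLocalMax f^[n + 1] c <;>
    cases s <;> simp only [HasExtremumType, h, hM] <;>
    generalize f^[n + 1] c = t <;> grind

theorem sgn_minMaxSeq (f : ℝ → ℝ) (c : ℝ) (n : ℕ) :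
    (minMaxSeq f c n).sgn = SignType.sign (f^[n] c - c) := by
  unfold minMaxSeq
  rcases lt_trichotomy (f^[n] c) c with h1 | h1 | h1
  · rw [sign_neg (sub_neg.2 h1)]
    split_ifs <;> rfl
  · rw [h1, sub_self, sign_zero]
    simp only [lt_irrefl, if_false, if_true]
    split_ifs <;> rfl
  · rw [sign_pos (sub_pos.2 h1)]
    split_ifs <;> first | rfl | (exfalso; linarith)

theorem minMaxSeq_mem_badSymbols_iff (hf : IsUnimodal f a b c) (n : ℕ) :
    minMaxSeq f c (n + 1) ∈ badSymbols ↔ BadExtr f^[n + 1] c c := by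
  unfold minMaxSeq BadExtr
  rcases hf.strictLocExtr_crit n with hM | hM
  · simp only [hM.isLocalMax, hM, hM.not_strictLocMin, if_true, true_and, false_and, or_false]
    split_ifs with h1 h2
    · simp only [h1.le, iff_true]; decide
    · simp [badSymbols, h2]
    · have : ¬ f^[n + 1] c ≤ c := fun h => h2 (le_antisymm h (not_lt.1 h1))
      simp only [this, iff_false]; decide
  · have hM' : ¬ StrictLocMax f^[n + 1] c := fun h => h.not_strictLocMin hM
    simp only [hM.not_isLocalMax, hM, hM', if_false, true_and, false_and, false_or]
    split_ifs with h1 h2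
    · simp only [h1.not_ge, iff_false]; decide
    · simp [badSymbols, h2]
    · simp only [not_lt.1 h1, iff_true]; decide

theorem badExtr_of_firstHit_iff (hf : IsUnimodal f a b c) {j k : ℕ} {x : ℝ}
    (hx : x ∈ firstHit f a b c k) :
    BadExtr f^[j + 1 + k] c x ↔ minMaxSeq f c (j + 1) ∈ badSymbols := by
  rw [hf.minMaxSeq_mem_badSymbols_iff, BadExtr, BadExtr, Function.iterate_add_apply, hx.2.1]
  rcases hf.strictLocExtr_crit j with h | h
  · have h' := hf.strictLocMax_of_firstHit hx h
    simp only [h, h', h.not_strictLocMin, h'.not_strictLocMin]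
  · have h' := hf.strictLocMin_of_firstHit hx h
    have h1 : ¬ StrictLocMax f^[j + 1] c := fun hh => hh.not_strictLocMin h
    have h2 : ¬ StrictLocMax f^[j + 1 + k] x := fun hh => hh.not_strictLocMin h'
    simp only [h, h', h1, h2]

theorem badExtr_iff (hf : IsUnimodal f a b c) {n : ℕ} {u w : ℝ} (hu : u ∈ turning f a b c n)
    (hw : w ∈ Icc a b) (huw : u ≠ w) (h : NoTurn f c n u w) :
    BadExtr f^[n] c u ↔
      (f^[n] w < f^[n] u ∧ f^[n] u ≤ c) ∨ (f^[n] u < f^[n] w ∧ c ≤ f^[n] u) := by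
  have hst := hf.strict_of_noTurn n (Ioo_subset_Icc_self hu.1) hw h
  unfold BadExtr
  rcases hf.strictLocExtr_of_mem_turning hu with hM | hM
  · have := hM.lt_of_strict huw hst
    simp [hM, hM.not_strictLocMin, this, this.not_gt]
  · have hM' : ¬ StrictLocMax f^[n] u := fun h => h.not_strictLocMin hM
    have := hM.lt_of_strict huw hst
    simp [hM, hM', this, this.not_gt]

theorem noTurn_comm {n : ℕ} {u v : ℝ} (h : NoTurn f c n u v) : NoTurn f c n v u := by
  unfold NoTurn at *; rwa [uIoo_comm]

open Classical in
theorem ncard_firstHit_inter_eq (hf : IsUnimodal f a b c) (n : ℕ) {u v : ℝ} (hu : u ∈ Icc a b)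
    (hv : v ∈ Icc a b) (h : NoTurn f c n u v) :
    ((firstHit f a b c n ∩ uIoo u v).ncard : ℤ) =
      if c ∈ uIoo (f^[n] u) (f^[n] v) then 1 else 0 := by
  obtain ⟨h1, h2⟩ := hf.ncard_firstHit_inter n hu hv h
  split_ifs with hc
  · obtain ⟨y, -, -, hy⟩ := h1 hc
    simp [hy]
  · simp [h2 hc]

open Classical in
theorem ncard_inner_lap (hf : IsUnimodal f a b c) {n : ℕ} {u v : ℝ} (hu : u ∈ turning f a b c n)
    (hv : v ∈ turning f a b c n) (huv : u ≠ v) (h : NoTurn f c n u v) :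
    ((firstHit f a b c n ∩ uIoo u v).ncard : ℤ) =
      1 - (if BadExtr f^[n] c u then 1 else 0) - (if BadExtr f^[n] c v then 1 else 0) := by
  have hu' := Ioo_subset_Icc_self hu.1
  have hv' := Ioo_subset_Icc_self hv.1
  rw [hf.ncard_firstHit_inter_eq n hu' hv' h, hf.badExtr_iff hu hv' huv h,
    hf.badExtr_iff hv hu' huv.symm (noTurn_comm h)]
  have hinj : f^[n] u ≠ f^[n] v := fun hh => huv ((hf.strict_of_noTurn n hu' hv' h).elim
    (fun hs => hs.injOn left_mem_uIcc right_mem_uIcc hh)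
    (fun hs => hs.injOn left_mem_uIcc right_mem_uIcc hh))
  generalize f^[n] u = s at *
  generalize f^[n] v = t at *
  rcases lt_or_gt_of_ne hinj with hst | hst
  · rw [uIoo_of_lt hst]
    simp only [hst, hst.not_gt, true_and, false_and, or_false, false_or]
    split_ifs <;> first | rfl | (exfalso; grind)
  · rw [uIoo_of_gt hst]
    simp only [hst, hst.not_gt, true_and, false_and, or_false, false_or]
    split_ifs <;> first | rfl | (exfalso; grind)

/-- Since `x` is at `c` at time `k`, `f^(m+1) x = f^(1+l) c`. So the sign test of the counter asks
whether the lap from `e` to `x` crosses `c`. -/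
theorem sign_condition_iff {e x : ℝ} {m k l : ℕ} (hk : k + l = m) (hx : x ∈ firstHit f a b c k) :
    SignType.sign (f^[m + 1] e - c) * (minMaxSeq f c (1 + l)).sgn < 0 ↔
      c ∈ uIoo (f^[m + 1] e) (f^[m + 1] x) := by
  have : f^[m + 1] x = f^[1 + l] c := by
    rw [show m + 1 = (1 + l) + k by omega, Function.iterate_add_apply, hx.2.1]
  rw [sgn_minMaxSeq, this, sign_mul_sign_neg_iff]

/-- The turning point of `f^(m+1)` next to `e` is tracked by the counter of `e`. -/
theorem exists_adjacent_turning (hf : IsUnimodal f a b c) {e : ℝ} (he : e ∈ Icc a b) (hec : e ≠ c)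
    (m : ℕ) : ∃ k x, k + endCounter f c e m = m ∧ x ∈ firstHit f a b c k ∧ e ≠ x ∧
      NoTurn f c (m + 1) e x := by
  induction m with
  | zero =>
    refine ⟨0, c, rfl, ⟨hf.mem_Ioo, rfl, fun k hk => absurd hk k.not_lt_zero⟩, hec, ?_⟩
    intro y hy k hk
    obtain rfl : k = 0 := by omega
    exact ne_right_of_mem_uIoo hy
  | succ m ih =>
    obtain ⟨k, x, hk, hx, hex, hno⟩ := ih
    have hxI := Ioo_subset_Icc_self hx.1
    obtain ⟨h1, h2⟩ := hf.ncard_firstHit_inter (m + 1) he hxI hno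
    -- On a crossing, a turning point `y` is born between `e` and `x` and the counter, which is the
    -- age of the neighbour of `e`, restarts at 0. Otherwise `x` remains the neighbour and ages by
    -- one.
    by_cases hc : c ∈ uIoo (f^[m + 1] e) (f^[m + 1] x)
    · obtain ⟨y, hy, hyN, hys⟩ := h1 hc
      have hsub : uIoo e y ⊆ uIoo e x := by
        intro z hz
        rcases le_total e x with h | h
        · rw [uIoo_of_le h] at hy ⊢
          rw [uIoo_of_le hy.1.le] at hz
          exact ⟨hz.1, hz.2.trans hy.2⟩
        · rw [uIoo_of_ge h] at hy ⊢
          rw [uIoo_of_ge hy.2.le] at hz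
          exact ⟨hy.1.trans hz.1, hz.2⟩
      have hcount : endCounter f c e (m + 1) = 0 := by
        rw [endCounter, if_pos ((sign_condition_iff hk hx).2 hc)]
      refine ⟨m + 1, y, by rw [hcount], hyN, (ne_left_of_mem_uIoo hy).symm, ?_⟩
      intro z hz i hi hic
      rcases Nat.lt_succ_iff_lt_or_eq.1 hi with hi | rfl
      · exact hno z (hsub hz) i hi hic
      · have : z ∈ firstHit f a b c (m + 1) ∩ uIoo e x := by
          refine ⟨⟨?_, hic, hno z (hsub hz)⟩, hsub hz⟩
          have := hsub hz
          rcases le_total e x with h | h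
          · rw [uIoo_of_le h] at this; exact ⟨he.1.trans_lt this.1, this.2.trans hx.1.2⟩
          · rw [uIoo_of_ge h] at this; exact ⟨hx.1.1.trans this.1, this.2.trans_le he.2⟩
        rw [hys] at this
        exact ne_right_of_mem_uIoo hz this
    · have hcount : endCounter f c e (m + 1) = endCounter f c e m + 1 := by
        rw [endCounter, if_neg (mt (sign_condition_iff hk hx).1 hc)]
      refine ⟨k, x, by rw [hcount]; omega, hx, hex, ?_⟩
      intro z hz i hi hic
      rcases Nat.lt_succ_iff_lt_or_eq.1 hi with hi | rfl
      · exact hno z hz i hi hic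
      · have hzN : z ∈ firstHit f a b c (m + 1) ∩ uIoo e x := by
          refine ⟨⟨?_, hic, hno z hz⟩, hz⟩
          rcases le_total e x with h | h
          · rw [uIoo_of_le h] at hz; exact ⟨he.1.trans_lt hz.1, hz.2.trans hx.1.2⟩
          · rw [uIoo_of_ge h] at hz; exact ⟨hx.1.1.trans hz.1, hz.2.trans_le he.2⟩
        rw [h2 hc] at hzN
        exact hzN

open Classical in
-- A crossing lap has a good inner end and no correction. A non-crossing lap loses its 1 either to a
-- bad `v` or, if `v` is good, to the correction. `hside` encodes that all interior points lie on
-- one side of `e`, so both end-points are covered.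
theorem ncard_end_lap (hf : IsUnimodal f a b c) {e : ℝ} (he : e ∈ Icc a b)
    (heT : e ∉ Ioo a b) (m : ℕ) {v : ℝ} (hv : v ∈ turning f a b c (m + 1))
    (h : NoTurn f c (m + 1) e v) (hside : ∀ x ∈ Ioo a b, x ∉ uIoo e v → v ∉ uIoo e x → x = v) :
    ((firstHit f a b c (m + 1) ∩ uIoo e v).ncard : ℤ) =
      1 - endCorrection f c e (m + 1) - (if BadExtr f^[m + 1] c v then 1 else 0) := by
  have hec : e ≠ c := by rintro rfl; exact heT hf.mem_Ioo
  obtain ⟨k, x, hk, hx, hex, hno⟩ := hf.exists_adjacent_turning he hec m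
  -- The tracked point `x` and `v` are both turning points next to `e`, so neither lies between `e`
  -- and the other.
  obtain rfl : x = v := by
    refine hside x hx.1 (fun hh => ?_) (fun hh => ?_)
    · exact h x hh k (by omega) hx.2.1
    · obtain ⟨-, i, hi, hic⟩ := hv
      exact hno v hh i hi hic
  have hxI := Ioo_subset_Icc_self hx.1
  have hbad := hf.badExtr_of_firstHit_iff (j := endCounter f c e m) hx
  rw [show endCounter f c e m + 1 + k = m + 1 by omega, Nat.add_comm (endCounter f c e m) 1] at hbad
  rw [hf.ncard_firstHit_inter_eq _ he hxI h, endCorrection, Nat.add_sub_cancel]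
  simp only [← hbad, sign_condition_iff hk hx]
  by_cases hc : c ∈ uIoo (f^[m + 1] e) (f^[m + 1] x)
  · have : ¬ BadExtr f^[m + 1] c x := by
      rw [hf.badExtr_iff hv he hex.symm (noTurn_comm h)]
      rintro (⟨h1, h2⟩ | ⟨h1, h2⟩)
      · rw [uIoo_of_lt h1] at hc; exact h2.not_gt hc.2
      · rw [uIoo_of_gt h1] at hc; exact h2.not_gt hc.1
    simp [-Function.iterate_succ, hc, this]
  · by_cases hB : BadExtr f^[m + 1] c x <;> simp [-Function.iterate_succ, hc, hB]

end IsUnimodal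

/-! ### Lap numbers and summation over the laps -/

namespace IsUnimodal

variable {f : ℝ → ℝ} {a b c : ℝ}

/-- The turning points of `f^n` in increasing order, with the end-points added. -/
theorem exists_turning_cuts (hf : IsUnimodal f a b c) (n : ℕ) :
    ∃ p : ℕ → ℝ, p 0 = a ∧ p ((turning f a b c n).ncard + 1) = b ∧
      (∀ i < (turning f a b c n).ncard + 1, p i < p (i + 1)) ∧
      (∀ i < (turning f a b c n).ncard, p (i + 1) ∈ turning f a b c n) ∧
      (∀ F : ℝ → ℤ, ∑ i ∈ Finset.range (turning f a b c n).ncard, F (p (i + 1)) =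
        ∑ x ∈ (hf.finite_turning n).toFinset, F x) ∧
      (∀ i < (turning f a b c n).ncard + 1, p i ∈ Icc a b) ∧
      ∀ i < (turning f a b c n).ncard + 1, NoTurn f c n (p i) (p (i + 1)) := by
  rw [Set.ncard_eq_toFinset_card _ (hf.finite_turning n)]
  set T := (hf.finite_turning n).toFinset with hT
  have hmem : ∀ x, x ∈ T ↔ x ∈ turning f a b c n := fun x => (hf.finite_turning n).mem_toFinset
  obtain ⟨p, h0, h1, h2, h3, h4⟩ := exists_cuts T hf.lt fun x hx => ((hmem x).1 hx).1
  have hI : ∀ i < T.card + 1, p i ∈ Icc a b := fun i hi =>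
    ⟨h0 ▸ le_of_forall_step h2 i.zero_le hi.le, h1 ▸ le_of_forall_step h2 hi.le le_rfl⟩
  have hI' : ∀ i < T.card + 1, p (i + 1) ≤ b := fun i hi => h1 ▸ le_of_forall_step h2 hi le_rfl
  refine ⟨p, h0, h1, h2, fun i hi => ?_, fun F => ?_, hI, fun i hi y hy k hk hyc => ?_⟩
  · rw [← hmem, ← h3]
    exact Finset.mem_image_of_mem _ (Finset.mem_range.2 hi)
  · conv_rhs => rw [← h3]
    rw [Finset.sum_image]
    -- The enumeration is injective because its image has full cardinality.
    refine Finset.card_image_iff.1 ?_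
    rw [h3, Finset.card_range]
  · rw [uIoo_of_le (h2 i hi).le] at hy
    exact h4 i hi y ((hmem y).2 ⟨⟨(hI i hi).1.trans_lt hy.1, hy.2.trans_le (hI' i hi)⟩,
      k, hk, hyc⟩) hy

/-- Cutting at the turning points suffices. Conversely, a strict extremum cannot be interior to a
monotone piece, so every turning point is among the `k - 1` interior cuts. -/
theorem isLeast_hasMonotonePieces (hf : IsUnimodal f a b c) (n : ℕ) :
    IsLeast {k : ℕ | HasMonotonePieces f^[n] a b k} ((turning f a b c n).ncard + 1) := by
  constructor
  · obtain ⟨p, h0, h1, h2, -, -, hI, hno⟩ := hf.exists_turning_cuts n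
    refine ⟨p, h0, h1, fun i hi => ⟨h2 i hi, ?_⟩⟩
    have hI' : p (i + 1) ∈ Icc a b :=
      ⟨(hI i hi).1.trans (h2 i hi).le, h1 ▸ le_of_forall_step h2 hi le_rfl⟩
    have := hf.strict_of_noTurn n (hI i hi) hI' (hno i hi)
    rw [uIcc_of_le (h2 i hi).le] at this
    exact this.imp (·.monotoneOn) (·.antitoneOn)
  · rintro k ⟨p, h0, hk, hp⟩
    have hkpos : 0 < k := by
      rcases Nat.eq_zero_or_pos k with rfl | h
      · exact absurd (h0.symm.trans hk) hf.lt.ne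
      · exact h
    have hsub : turning f a b c n ⊆ ((Finset.Ioo 0 k).image p : Finset ℝ) := by
      intro x hx
      obtain ⟨i, hi, hxi⟩ := exists_step_mem_Ico (p := p) (h0.le.trans hx.1.1.le)
        (hx.1.2.trans_eq hk.symm)
      have hxp : x = p i := by
        by_contra hne
        exact not_monotone_of_strictLocExtr ⟨lt_of_le_of_ne hxi.1 (Ne.symm hne), hxi.2⟩
          (hf.strictLocExtr_of_mem_turning hx) (hp i hi).2
      have hi0 : i ≠ 0 := by rintro rfl; exact hx.1.1.ne' (hxp.trans h0)
      rw [Finset.coe_image]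
      exact ⟨i, by simpa using ⟨Nat.pos_of_ne_zero hi0, hi⟩, hxp.symm⟩
    have h1 := Set.ncard_le_ncard hsub (Finset.finite_toSet _)
    rw [Set.ncard_coe_finset] at h1
    have h2 := h1.trans Finset.card_image_le
    rw [Nat.card_Ioo] at h2
    omega

theorem lapNumber_eq (hf : IsUnimodal f a b c) (n : ℕ) :
    lapNumber f a b n = (turning f a b c n).ncard + 1 :=
  (hf.isLeast_hasMonotonePieces n).csInf_eq

theorem lapNumber_zero (hf : IsUnimodal f a b c) : lapNumber f a b 0 = 1 := by
  have : turning f a b c 0 = ∅ := eq_empty_of_forall_notMem fun _ ⟨_, k, hk, _⟩ => k.not_lt_zero hk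
  rw [hf.lapNumber_eq, this, Set.ncard_empty]

theorem lapNumber_succ (hf : IsUnimodal f a b c) (n : ℕ) :
    lapNumber f a b (n + 1) = lapNumber f a b n + (firstHit f a b c n).ncard := by
  rw [hf.lapNumber_eq, hf.lapNumber_eq, hf.ncard_turning_succ]
  omega

/-- The new turning points of `f^(n+1)` are distributed over the laps of `f^n`. -/
theorem ncard_firstHit_eq_sum {n K : ℕ} {p : ℕ → ℝ} (hf : IsUnimodal f a b c) (h0 : p 0 = a)
    (hK : p (K + 1) = b) (hp : ∀ i < K + 1, p i < p (i + 1))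
    (hT : ∀ i < K, p (i + 1) ∈ turning f a b c n) :
    (firstHit f a b c n).ncard =
      ∑ i ∈ Finset.range (K + 1), (firstHit f a b c n ∩ uIoo (p i) (p (i + 1))).ncard := by
  classical
  set N := (hf.finite_firstHit n).toFinset with hN
  have hmem : ∀ x, x ∈ N ↔ x ∈ firstHit f a b c n := fun x => (hf.finite_firstHit n).mem_toFinset
  have hcard : ∀ i, (firstHit f a b c n ∩ uIoo (p i) (p (i + 1))).ncard =
      (N.filter (· ∈ uIoo (p i) (p (i + 1)))).card := fun i => by
    rw [← Set.ncard_coe_finset]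
    congr 1
    ext x
    simp [hmem]
  simp only [hcard]
  rw [← Finset.card_biUnion, Set.ncard_eq_toFinset_card _ (hf.finite_firstHit n)]
  · congr 1
    ext x
    simp only [← hN, Finset.mem_biUnion, Finset.mem_filter, Finset.mem_range]
    refine ⟨fun hx => ?_, fun ⟨_, _, hx, _⟩ => hx⟩
    have hx' := (hmem x).1 hx
    obtain ⟨i, hi, hxi⟩ := exists_step_mem_Ico (p := p) (h0.le.trans hx'.1.1.le)
      (hx'.1.2.trans_eq hK.symm)
    refine ⟨i, hi, hx, ?_⟩
    rw [uIoo_of_le (hp i hi).le]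
    refine ⟨lt_of_le_of_ne hxi.1 ?_, hxi.2⟩
    rintro rfl
    rcases i with _ | i
    · exact hx'.1.1.ne' h0
    · exact Set.disjoint_left.1 (disjoint_turning_firstHit n) (hT i (by omega)) hx'
  · intro i hi j hj hij
    wlog hlt : i < j generalizing i j
    · exact (this hj hi hij.symm (lt_of_le_of_ne (not_lt.1 hlt) hij.symm)).symm
    have hi' := Finset.mem_range.1 hi
    have hj' := Finset.mem_range.1 hj
    refine Finset.disjoint_left.2 fun x hx hx' => ?_
    have h1 := (Finset.mem_filter.1 hx).2
    have h2 := (Finset.mem_filter.1 hx').2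
    rw [uIoo_of_le (hp i hi').le] at h1
    rw [uIoo_of_le (hp j hj').le] at h2
    exact ((le_of_forall_step hp hlt hj'.le).trans_lt h2.1).not_gt h1.2

open Classical in
-- Turning points are sorted by first hitting time `n - j`; all those of one class have type `ω_j`,
-- so a class is entirely bad or entirely good.
theorem sum_badIndices (hf : IsUnimodal f a b c) (n : ℕ) :
    ∑ j ∈ badIndices f c n, ((firstHit f a b c (n - j)).ncard : ℤ) =
      ∑ x ∈ (hf.finite_turning n).toFinset, if BadExtr f^[n] c x then 1 else 0 := by
  rw [← Finset.sum_filter, Finset.sum_const, nsmul_one]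
  have hcard : ∀ j, (firstHit f a b c (n - j)).ncard =
      (hf.finite_firstHit (n - j)).toFinset.card := fun j => Set.ncard_eq_toFinset_card _ _
  simp only [hcard]
  rw [← Nat.cast_sum, ← Finset.card_biUnion]
  · congr 2
    ext x
    simp only [Finset.mem_biUnion, Finset.mem_filter, badIndices, Set.Finite.mem_toFinset,
      Finset.mem_Icc]
    constructor
    · rintro ⟨j, ⟨⟨hj1, hjn⟩, hj⟩, hx⟩
      refine ⟨mem_turning_of_firstHit (by omega) hx, ?_⟩
      obtain ⟨i, rfl⟩ : ∃ i, j = i + 1 := ⟨j - 1, by omega⟩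
      have := (hf.badExtr_of_firstHit_iff (j := i) hx).2 hj
      rwa [show i + 1 + (n - (i + 1)) = n by omega] at this
    · rintro ⟨hx, hB⟩
      obtain ⟨k, hk, hxk⟩ := exists_firstHit_of_mem_turning hx
      have hB' := (hf.badExtr_of_firstHit_iff (j := n - k - 1) hxk).1
      rw [show n - k - 1 + 1 + k = n by omega, show n - k - 1 + 1 = n - k by omega] at hB'
      exact ⟨n - k, ⟨⟨by omega, by omega⟩, hB' hB⟩, by rwa [show n - (n - k) = k by omega]⟩
  · intro i hi j hj hij
    have hi' := (Finset.mem_Icc.1 (Finset.mem_filter.1 hi).1).2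
    have hj' := (Finset.mem_Icc.1 (Finset.mem_filter.1 hj).1).2
    refine Finset.disjoint_left.2 fun x hx hx' => hij ?_
    have := firstHit_unique ((Set.Finite.mem_toFinset _).1 hx) ((Set.Finite.mem_toFinset _).1 hx')
    omega

open Classical in
/-- The number of laps of `f^(m+1)` that cross the critical point. -/
theorem ncard_firstHit_formula (hf : IsUnimodal f a b c) (m : ℕ) :
    ((firstHit f a b c (m + 1)).ncard : ℤ) = (turning f a b c (m + 1)).ncard + 1
      - 2 * ∑ x ∈ (hf.finite_turning (m + 1)).toFinset, (if BadExtr f^[m + 1] c x then 1 else 0)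
      - endCorrection f c a (m + 1) - endCorrection f c b (m + 1) := by
  obtain ⟨p, h0, h1, h2, hT, hsum, hI, hno⟩ := hf.exists_turning_cuts (m + 1)
  -- `c` itself is a turning point, so no lap has both `a` and `b` as ends.
  have hKpos : 0 < (turning f a b c (m + 1)).ncard :=
    (Set.ncard_pos (hf.finite_turning _)).2 ⟨c, hf.mem_Ioo, 0, m.succ_pos, rfl⟩
  rw [hf.ncard_firstHit_eq_sum h0 h1 h2 hT]
  set K := (turning f a b c (m + 1)).ncard with hKdef
  -- `W i` is the cost of the cut `p i` to each adjacent lap, which makes the count uniform: lap `i`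
  -- contributes `1 - W i - W (i + 1)`.
  set W : ℕ → ℤ := fun i => if i = 0 then endCorrection f c a (m + 1) else
    if i = K + 1 then endCorrection f c b (m + 1) else
      if BadExtr f^[m + 1] c (p i) then 1 else 0 with hW
  have haT : a ∉ Ioo a b := fun h => lt_irrefl _ h.1
  have hbT : b ∉ Ioo a b := fun h => lt_irrefl _ h.2
  have hlap : ∀ i ∈ Finset.range (K + 1),
      ((firstHit f a b c (m + 1) ∩ uIoo (p i) (p (i + 1))).ncard : ℤ) = 1 - W i - W (i + 1) := by
    intro i hi
    have hi' := Finset.mem_range.1 hi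
    rcases Nat.eq_zero_or_pos i with rfl | hipos
    · have hv := hT 0 hKpos
      have hn := hno 0 hi'
      rw [h0] at hn ⊢
      rw [hf.ncard_end_lap (left_mem_Icc.2 hf.lt.le) haT m hv hn]
      · simp [-Function.iterate_succ, hW, hKpos.ne']
      · intro x hx h3 h4
        rw [uIoo_of_le hv.1.1.le] at h3
        rw [uIoo_of_le hx.1.le] at h4
        exact le_antisymm (not_lt.1 fun h => h4 ⟨hv.1.1, h⟩) (not_lt.1 fun h => h3 ⟨hx.1, h⟩)
    · obtain ⟨l, rfl⟩ : ∃ l, i = l + 1 := ⟨i - 1, by omega⟩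
      have hu := hT l (by omega)
      rcases Nat.lt_or_ge (l + 1) K with hlK | hlK
      · rw [hf.ncard_inner_lap hu (hT (l + 1) hlK) (h2 _ hi').ne (hno _ hi')]
        have e1 : l ≠ K := by omega
        have e2 : l + 1 ≠ K := by omega
        simp [-Function.iterate_succ, hW, e1, e2]
      · obtain hKl : l + 1 = K := by omega
        have hn := noTurn_comm (hno _ hi')
        rw [hKl] at hu
        rw [hKl, h1] at hn
        rw [hKl, h1, uIoo_comm, hf.ncard_end_lap (right_mem_Icc.2 hf.lt.le) hbT m hu hn]
        · simp only [hW, hKpos.ne', Nat.add_one_ne_zero, if_false,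
            if_true]
          simp only [(Nat.lt_succ_self K).ne, if_false]
          ring
        · intro x hx h3 h4
          rw [uIoo_of_ge hu.1.2.le] at h3
          rw [uIoo_of_ge hx.2.le] at h4
          exact le_antisymm (not_lt.1 fun h => h3 ⟨h, hx.2⟩) (not_lt.1 fun h => h4 ⟨h, hu.1.2⟩)
  have hmid : ∑ i ∈ Finset.range K, W (i + 1) =
      ∑ x ∈ (hf.finite_turning (m + 1)).toFinset, (if BadExtr f^[m + 1] c x then 1 else 0) := by
    rw [← hsum]
    refine Finset.sum_congr rfl fun i hi => ?_
    have : i ≠ K := (Finset.mem_range.1 hi).ne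
    simp [-Function.iterate_succ, hW, this]
  have hW0 : W 0 = endCorrection f c a (m + 1) := by simp [-Function.iterate_succ, hW]
  have hW1 : W (K + 1) = endCorrection f c b (m + 1) := by simp [-Function.iterate_succ, hW]
  -- Interior cuts occur in both shifted sums, the cuts `0` and `K + 1` in only one: hence the
  -- factor 2 on the bad points alone.
  rw [Nat.cast_sum, Finset.sum_congr rfl hlap, Finset.sum_sub_distrib, Finset.sum_sub_distrib,
    Finset.sum_range_succ' W, Finset.sum_range_succ (fun i => W (i + 1)), hmid, hW0, hW1]
  simp [-Function.iterate_succ]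
  ring

end IsUnimodal

/-! ### The recursion for the lap numbers -/

theorem theorem3p4 (f : ℝ → ℝ) (a b c : ℝ) (hf : IsUnimodal f a b c) :
    -- the lap numbers are genuine (finite, attained) minima
    (∀ n : ℕ, IsLeast {k : ℕ | HasMonotonePieces f^[n] a b k} (lapNumber f a b n)) ∧
    -- each iterate has exactly one extremum type at the critical point, recorded by the MMS
    (∀ n : ℕ, 1 ≤ n → ∀ s : MinMaxSymbol,
      HasExtremumType f^[n] c c s ↔ s = minMaxSeq f c n) ∧
    lapNumber f a b 0 = 1 ∧
    ∀ n : ℕ, 1 ≤ n →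
      (lapNumber f a b (n + 1) : ℤ) =
        2 * (lapNumber f a b n : ℤ)
          - 2 * ∑ j ∈ badIndices f c n,
              ((lapNumber f a b (n + 1 - j) : ℤ) - (lapNumber f a b (n - j) : ℤ))
          - endCorrection f c a n - endCorrection f c b n := by
  refine ⟨fun n => ?_, fun n hn s => ?_, hf.lapNumber_zero, fun n hn => ?_⟩
  · rw [hf.lapNumber_eq]
    exact hf.isLeast_hasMonotonePieces n
  · obtain ⟨m, rfl⟩ := Nat.exists_eq_add_of_le' hn
    exact hf.hasExtremumType_iff m s
  · have hsum : ∑ j ∈ badIndices f c n,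
        ((lapNumber f a b (n + 1 - j) : ℤ) - (lapNumber f a b (n - j) : ℤ)) =
        ∑ j ∈ badIndices f c n, ((firstHit f a b c (n - j)).ncard : ℤ) := by
      refine Finset.sum_congr rfl fun j hj => ?_
      have hj' := (Finset.mem_Icc.1 (Finset.mem_filter.1 hj).1).2
      rw [Nat.sub_add_comm hj', hf.lapNumber_succ]
      push_cast
      ring
    rw [hsum, hf.sum_badIndices, hf.lapNumber_succ]
    obtain ⟨m, rfl⟩ := Nat.exists_eq_add_of_le' hn
    push_cast
    rw [hf.ncard_firstHit_formula m, hf.lapNumber_eq]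
    push_cast
    ring
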